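/- Call a (nondegenerate, closed) triangle in the Euclidean plane an \emph{$H$-triangle} if one of its sides is parallel to the $x$-axis. Let $n \ge 0$ be an integer. The largest $\varepsilon > 0$ such that an equilateral $H$-triangle $T$ of side $n + \varepsilon$ can be covered by $n^2 + 2$ equilateral $H$-triangles of side $1$ is $$\varepsilon = \frac{1}{n+1}.$$ This holds both when ``an equilateral $H$-triangle $T$ of side $n+\varepsilon$'' is read as ``some'' and when it is read as ``every'' such triangle; in particular the maximum is attained. (The covering triangles may be placed anywhere, may point upwards or downwards, and may overlap.) -/

import Mathlib

/-- The Euclidean plane. -/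
abbrev HCover.Plane : Type := EuclideanSpace ℝ (Fin 2)

/-- A (nondegenerate) triangle in the plane is an `H`-triangle if one of its sides is parallel to
the `x`-axis, i.e. two of its vertices have the same `y`-coordinate. -/
def HCover.IsHTriangle (T : Affine.Triangle ℝ HCover.Plane) : Prop :=
  ∃ i j : Fin 3, i ≠ j ∧ T.points i 1 = T.points j 1

/-- `T` is an equilateral `H`-triangle of side `s`. -/
def HCover.IsEquilateralH (T : Affine.Triangle ℝ HCover.Plane) (s : ℝ) : Prop :=
  HCover.IsHTriangle T ∧ ∀ i j : Fin 3, i ≠ j → dist (T.points i) (T.points j) = s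

/-- `T` (as a closed region, boundary included) can be covered by `N` unit equilateral
`H`-triangles, placed anywhere and pointing upwards or downwards, overlaps being allowed. -/
def HCover.Coverable (N : ℕ) (T : Affine.Triangle ℝ HCover.Plane) : Prop :=
  ∃ S : Fin N → Affine.Triangle ℝ HCover.Plane,
    (∀ k, HCover.IsEquilateralH (S k) 1) ∧ T.closedInterior ⊆ ⋃ k, (S k).closedInterior

/-! ### Oblique coordinates for equilateral H-triangles. -/

namespace HCover

open Set

/-! Attainment: from a triangle of side n + 1/(n+1), n ≥ 1, cut off a bottom strip that n+1 upward
and n downward overlapping unit triangles still cover (`unitCovered_strip`). The rest has side n-1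
and takes (n-1)^2 more, giving n^2+2.

Maximality: area alone is too weak, so compare lengths on the horizontal lines at heights t, t+1,
t+2, ... above the base. A unit triangle of sign σ and base height β contributes at most 1 -
fract(σ(t-β)), which integrates to 1/2 over a period; let f(t) be the sum over all triangles, with
integral (n^2+2)/2. It is at least the total section length W(t) of the big triangle, with integral
(n+ε)^2/2. Modulo 1 the waste f - W is affine on [0,ε] and on [ε,1], with integer slopes k+1 and k,
where k is even because the number of signs fixes the parity of their sum. Being nonnegative, the
waste is at least its fractional part (`fract_le_sum_sub`), and the integral of that is too large if
ε > 1/(n+1) (`wasted_length_bound`). The contradiction is drawn in `le_of_cover_of_le_one`; n = 0 is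
a pigeonhole on the vertices. -/

/-- The closed triangle with a vertex at `(a, b)` and side `s` in oblique coordinates, pointing
upwards for `σ = 1` and downwards for `σ = -1`. -/
def InTri (σ a b s x y : ℝ) : Prop :=
  0 ≤ σ * (x - a) ∧ 0 ≤ σ * (y - b) ∧ σ * (x - a) + σ * (y - b) ≤ s

/-- First oblique coordinate of a point of the plane. -/
noncomputable def obX (p : Plane) : ℝ := p 0 - p 1 / √3

/-- Second oblique coordinate of a point of the plane. -/
noncomputable def obY (p : Plane) : ℝ := 2 * p 1 / √3

/-- The point with given oblique coordinates. -/
noncomputable def ofOb (x y : ℝ) : Plane := !₂[x + y / 2, √3 / 2 * y]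

@[simp] lemma obX_ofOb (x y : ℝ) : obX (ofOb x y) = x := by
  have h : √3 ≠ 0 := by positivity
  simp only [obX, ofOb, PiLp.toLp_apply, Matrix.cons_val_zero, Matrix.cons_val_one]
  field_simp
  ring

@[simp] lemma obY_ofOb (x y : ℝ) : obY (ofOb x y) = y := by
  have h : √3 ≠ 0 := by positivity
  simp [obY, ofOb]
  field_simp

lemma ofOb_obX_obY (p : Plane) : ofOb (obX p) (obY p) = p := by
  have h : √3 ≠ 0 := by positivity
  ext i
  fin_cases i
  · simp [obX, obY, ofOb]
    ring
  · simp [obX, obY, ofOb]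

lemma dist_ofOb (x y x' y' : ℝ) :
    dist (ofOb x y) (ofOb x' y') =
      √((x - x') ^ 2 + (x - x') * (y - y') + (y - y') ^ 2) := by
  have h : √3 ^ 2 = 3 := Real.sq_sqrt (by norm_num)
  rw [EuclideanSpace.dist_eq]
  congr 1
  simp only [ofOb, Fin.sum_univ_two, Real.dist_eq, sq_abs]
  simp
  linear_combination ((y - y') ^ 2 / 4) * h

lemma closedInterior_eq (T : Affine.Triangle ℝ Plane) {σ a b s : ℝ} (hσ : σ = 1 ∨ σ = -1)
    (hs : 0 < s) {i j l : Fin 3} (hij : i ≠ j) (hil : i ≠ l) (hjl : j ≠ l)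
    (hi : T.points i = ofOb a b) (hj : T.points j = ofOb (a + σ * s) b)
    (hl : T.points l = ofOb a (b + σ * s)) :
    T.closedInterior = {p | InTri σ a b s (obX p) (obY p)} := by
  have hσ2 : σ * σ = 1 := by rcases hσ with rfl | rfl <;> norm_num
  rw [← Affine.Simplex.convexHull_eq_closedInterior]
  apply Subset.antisymm
  · apply convexHull_min
    · rintro _ ⟨k, rfl⟩
      have : k = i ∨ k = j ∨ k = l := by omega
      rcases this with rfl | rfl | rfl
      · simp [hi, InTri, hs.le]
      · simp [hj, InTri, ← mul_assoc, hσ2, hs.le]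
      · simp [hl, InTri, ← mul_assoc, hσ2, hs.le]
    · intro p hp q hq α β hα hβ hαβ
      obtain ⟨h1, h2, h3⟩ := hp
      obtain ⟨h4, h5, h6⟩ := hq
      have eX : σ * (obX (α • p + β • q) - a) = α * (σ * (obX p - a)) + β * (σ * (obX q - a)) := by
        simp [obX]
        linear_combination (a * σ) * hαβ
      have eY : σ * (obY (α • p + β • q) - b) = α * (σ * (obY p - b)) + β * (σ * (obY q - b)) := by
        simp [obY]
        linear_combination (b * σ) * hαβ
      refine ⟨?_, ?_, ?_⟩
      · rw [eX]; positivity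
      · rw [eY]; positivity
      · rw [eX, eY]
        calc _ = α * (σ * (obX p - a) + σ * (obY p - b))
              + β * (σ * (obX q - a) + σ * (obY q - b)) := by ring
          _ ≤ α * s + β * s := by gcongr
          _ = s := by rw [← add_mul, hαβ, one_mul]
  · rintro p ⟨h1, h2, h3⟩
    have hc := convex_convexHull ℝ (range T.points)
    have hm : ∀ k, T.points k ∈ convexHull ℝ (range T.points) := fun k =>
      subset_convexHull ℝ _ ⟨k, rfl⟩
    let w : Fin 3 → ℝ := fun k => if k = i then 1 - (σ * (obX p - a) + σ * (obY p - b)) / s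
      else if k = j then σ * (obX p - a) / s else σ * (obY p - b) / s
    have hu : (Finset.univ : Finset (Fin 3)) = {i, j, l} := by
      ext k; simp; omega
    have key := hc.sum_mem (t := Finset.univ) (w := w) (z := T.points) (fun k _ => by
      simp only [w]
      split_ifs
      · rw [sub_nonneg, div_le_one hs]; exact h3
      · positivity
      · positivity) (by
      rw [hu, Finset.sum_insert (by simp [hij, hil]), Finset.sum_pair hjl]
      simp [w, hij.symm, hil.symm, hjl.symm]
      ring) (fun k _ => hm k)
    convert key using 1
    rw [hu, Finset.sum_insert (by simp [hij, hil]), Finset.sum_pair hjl, hi, hj, hl]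
    rw [← ofOb_obX_obY p]
    generalize hx : obX p = x at *
    generalize hy : obY p = y at *
    ext k
    rcases hσ with rfl | rfl <;> fin_cases k <;>
    · simp [w, hij.symm, hil.symm, hjl.symm, ofOb, hx, hy]
      field_simp
      ring

/-- Squared length in oblique coordinates is u²+uv+v², which forces the base and the apex offset to
be ±s. The sign of the apex offset is σ, and it decides which base vertex is the corner. -/
lemma exists_region (T : Affine.Triangle ℝ Plane) {s : ℝ} (hs : 0 < s)
    (hT : IsEquilateralH T s) : ∃ σ a b : ℝ, (σ = 1 ∨ σ = -1) ∧
      T.closedInterior = {p | InTri σ a b s (obX p) (obY p)} := by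
  obtain ⟨⟨i, j, hij, hy⟩, hd⟩ := hT
  obtain ⟨l, hil, hjl⟩ : ∃ l : Fin 3, i ≠ l ∧ j ≠ l := by
    clear hy
    revert i j
    decide
  have dij := hd i j hij
  have dil := hd i l hil
  have djl := hd j l hjl
  have hoy : obY (T.points i) = obY (T.points j) := by simp only [obY, hy]
  rw [← ofOb_obX_obY (T.points i)] at dij dil
  rw [← ofOb_obX_obY (T.points j)] at dij djl
  rw [← ofOb_obX_obY (T.points l)] at dil djl
  have ei := ofOb_obX_obY (T.points i)
  have ej := ofOb_obX_obY (T.points j)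
  have el := ofOb_obX_obY (T.points l)
  rw [← hoy] at dij djl ej
  rw [dist_ofOb, Real.sqrt_eq_iff_mul_self_eq_of_pos hs] at dij dil djl
  generalize obX (T.points i) = x1 at *
  generalize obX (T.points j) = x2 at *
  generalize obX (T.points l) = x3 at *
  generalize obY (T.points i) = y at *
  generalize obY (T.points l) = y3 at *
  have e1 : (x1 - x2 - s) * (x1 - x2 + s) = 0 := by linear_combination -dij
  have e2 : (x1 - x2) * (2 * x3 - x1 - x2 + y3 - y) = 0 := by linear_combination dil - djl
  have hx : x1 - x2 ≠ 0 := by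
    intro h0
    rw [h0] at e1
    have : s * s = 0 := by linear_combination -e1
    exact hs.ne' (mul_self_eq_zero.1 this)
  have e3 : 2 * x3 - x1 - x2 + y3 - y = 0 := (mul_eq_zero.1 e2).resolve_left hx
  have e4 : (y3 - y - s) * (y3 - y + s) = 0 := by
    have : y3 - y = x1 + x2 - 2 * x3 := by linear_combination e3
    nlinarith
  rcases mul_eq_zero.1 e1 with f1 | f1 <;> rcases mul_eq_zero.1 e4 with f2 | f2
  · refine ⟨1, x2, y, Or.inl rfl, closedInterior_eq T (Or.inl rfl) hs hij.symm hjl hil ej.symm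
      ?_ ?_⟩
    · rw [← ei]; congr 1; linarith
    · rw [← el]; congr 1 <;> linarith
  · refine ⟨-1, x1, y, Or.inr rfl, closedInterior_eq T (Or.inr rfl) hs hij hil hjl ei.symm
      ?_ ?_⟩
    · rw [← ej]; congr 1; linarith
    · rw [← el]; congr 1 <;> linarith
  · refine ⟨1, x1, y, Or.inl rfl, closedInterior_eq T (Or.inl rfl) hs hij hil hjl ei.symm
      ?_ ?_⟩
    · rw [← ej]; congr 1; linarith
    · rw [← el]; congr 1 <;> linarith
  · refine ⟨-1, x2, y, Or.inr rfl, closedInterior_eq T (Or.inr rfl) hs hij.symm hjl hil ej.symm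
      ?_ ?_⟩
    · rw [← ei]; congr 1; linarith
    · rw [← el]; congr 1 <;> linarith

lemma exists_triangle {σ s : ℝ} (a b : ℝ) (hσ : σ = 1 ∨ σ = -1) (hs : 0 < s) :
    ∃ T : Affine.Triangle ℝ Plane, IsEquilateralH T s ∧
      T.closedInterior = {p | InTri σ a b s (obX p) (obY p)} := by
  have hσ2 : σ ^ 2 = 1 := by rcases hσ with rfl | rfl <;> norm_num
  have hσ0 : σ ≠ 0 := by rintro rfl; norm_num at hσ2
  have h : √3 ≠ 0 := by positivity
  have hind : AffineIndependent ℝ ![ofOb a b, ofOb (a + σ * s) b, ofOb a (b + σ * s)] := by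
    rw [affineIndependent_iff_of_fintype]
    intro w hw0 hw1
    rw [Finset.weightedVSub_eq_linear_combination _ hw0] at hw1
    have hX := congrArg obX hw1
    have hY := congrArg obY hw1
    simp [Fin.sum_univ_three, obX, obY, ofOb] at hX hY hw0
    field_simp at hX hY
    have hσs : σ * s ≠ 0 := mul_ne_zero hσ0 hs.ne'
    have h2 : w 2 = 0 := by
      refine (mul_eq_zero.1 (?_ : (σ * s) * w 2 = 0)).resolve_left hσs
      have hY' := (mul_eq_zero.1 (hY.trans (mul_zero 2))).resolve_left h
      linear_combination hY' - b * hw0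
    have h1 : w 1 = 0 := by
      refine (mul_eq_zero.1 (?_ : (σ * s) * w 1 = 0)).resolve_left hσs
      linear_combination hX / 2 - a * hw0
    intro i
    fin_cases i
    · simpa [h1, h2] using hw0
    · exact h1
    · exact h2
  refine ⟨⟨_, hind⟩, ⟨⟨0, 1, by decide, ?_⟩, ?_⟩, ?_⟩
  · simp [ofOb]
  · intro i j hij
    have hs2 : √(σ ^ 2 * s ^ 2) = s := by rw [hσ2, one_mul, Real.sqrt_sq hs.le]
    fin_cases i <;> fin_cases j <;> first | exact absurd rfl hij | skip
    all_goals
      simp [dist_ofOb]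
      convert hs2 using 2
      ring
  · exact closedInterior_eq _ hσ hs (i := 0) (j := 1) (l := 2) (by decide) (by decide) (by decide)
      rfl rfl rfl

end HCover

/-! ### The covering by n² + 2 triangles. -/

namespace HCover

open Set

/-- The set `A` (in oblique coordinates) is covered by `N` unit triangles. -/
def UnitCovered (N : ℕ) (A : Set (ℝ × ℝ)) : Prop :=
  ∃ L : List (ℝ × ℝ × ℝ), L.length = N ∧ (∀ q ∈ L, q.1 = 1 ∨ q.1 = -1) ∧
    ∀ p ∈ A, ∃ q ∈ L, InTri q.1 q.2.1 q.2.2 1 p.1 p.2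

lemma UnitCovered.union {M N : ℕ} {A B : Set (ℝ × ℝ)} (hA : UnitCovered M A) (hB : UnitCovered N B) :
    UnitCovered (M + N) (A ∪ B) := by
  obtain ⟨L, rfl, h1, h2⟩ := hA
  obtain ⟨L', rfl, h1', h2'⟩ := hB
  refine ⟨L ++ L', List.length_append, fun q hq => ?_, ?_⟩
  · exact (List.mem_append.1 hq).elim (h1 q) (h1' q)
  · rintro p (hp | hp)
    · obtain ⟨q, hq, h⟩ := h2 p hp
      exact ⟨q, List.mem_append_left _ hq, h⟩
    · obtain ⟨q, hq, h⟩ := h2' p hp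
      exact ⟨q, List.mem_append_right _ hq, h⟩

lemma UnitCovered.mono {N : ℕ} {A B : Set (ℝ × ℝ)} (hB : UnitCovered N B) (h : A ⊆ B) :
    UnitCovered N A := by
  obtain ⟨L, hL, h1, h2⟩ := hB
  exact ⟨L, hL, h1, fun p hp => h2 p (h hp)⟩

/-- Reflecting in the origin. -/
lemma UnitCovered.neg {N : ℕ} {A B : Set (ℝ × ℝ)} (hB : UnitCovered N B) (h : ∀ p ∈ A, -p ∈ B) :
    UnitCovered N A := by
  obtain ⟨L, hL, h1, h2⟩ := hB
  refine ⟨L.map fun q => -q, by simpa, ?_, fun p hp => ?_⟩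
  · intro q hq
    obtain ⟨q, hq', rfl⟩ := List.mem_map.1 hq
    rcases h1 q hq' with h | h <;> simp [h]
  · obtain ⟨q, hq, hq1, hq2, hq3⟩ := h2 _ (h p hp)
    refine ⟨-q, List.mem_map.2 ⟨q, hq, rfl⟩, ?_, ?_, ?_⟩ <;>
    · simp only [Prod.fst_neg, Prod.snd_neg] at *
      linarith

/-- A trapezoid of height `2 - d` is covered by `n + 1` upward triangles whose bases are spaced by
`d`, and `n` downward triangles filling the gaps. -/
lemma unitCovered_strip (n : ℕ) (a b : ℝ) (d : ℝ) :
    UnitCovered (2 * n + 1) {p | InTri 1 a b (n * d + 1) p.1 p.2 ∧ p.2 ≤ b + (2 - d)} := by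
  refine ⟨(List.range (n + 1)).map (fun j : ℕ => (1, a + j * d, b)) ++
    (List.range n).map (fun j : ℕ => (-1, a + (j + 1 : ℕ) * d, b + (2 - d))), ?_, ?_, ?_⟩
  · simp; ring
  · intro q hq
    simp at hq
    rcases hq with ⟨_, _, rfl⟩ | ⟨_, _, rfl⟩ <;> simp
  · rintro ⟨x, y⟩ ⟨⟨h1, h2, h3⟩, h4⟩
    simp only [one_mul] at h1 h2 h3 h4
    classical
    let P : ℕ → Prop := fun j => a + j * d ≤ x
    have hP0 : P 0 := by simp [P]; linarith
    set j := Nat.findGreatest P n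
    have hj : a + j * d ≤ x := Nat.findGreatest_spec (P := P) (Nat.zero_le n) hP0
    have hjn : j ≤ n := Nat.findGreatest_le n
    by_cases hc : (x - (a + j * d)) + (y - b) ≤ 1
    · refine ⟨(1, a + j * d, b), ?_, ?_⟩
      · simp only [List.mem_append, List.mem_map, List.mem_range]
        exact Or.inl ⟨j, by omega, rfl⟩
      · refine ⟨?_, ?_, ?_⟩ <;> simp <;> linarith
    · push Not at hc
      have hlt : j < n := by
        rcases hjn.lt_or_eq with h | h
        · exact h
        · rw [h] at hc
          linarith
      have hx : x < a + (j + 1 : ℕ) * d := by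
        by_contra! hx
        exact Nat.findGreatest_is_greatest (P := P) (Nat.lt_succ_self j) hlt hx
      -- The third side of this downward triangle lies on the slanted side of the j-th upward one,
      -- so `hc` is its last inequality.
      refine ⟨(-1, a + (j + 1 : ℕ) * d, b + (2 - d)), ?_, ?_⟩
      · simp only [List.mem_append, List.mem_map, List.mem_range]
        exact Or.inr ⟨j, hlt, rfl⟩
      · push_cast at hx
        refine ⟨?_, ?_, ?_⟩ <;> simp <;> linarith

/-- The clause `n ≠ 0` is needed: a triangle of side 0 is a point, which no empty family covers. -/
lemma unitCovered_sq (n : ℕ) (a b : ℝ) : UnitCovered (n ^ 2) {p | InTri 1 a b n p.1 p.2 ∧ n ≠ 0} := by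
  induction n generalizing b with
  | zero => exact ⟨[], rfl, by simp, by simp⟩
  | succ n ih =>
    have h := (ih (b + 1)).union (unitCovered_strip n a b 1)
    rw [show n ^ 2 + (2 * n + 1) = (n + 1) ^ 2 by ring] at h
    refine h.mono ?_
    rintro ⟨x, y⟩ ⟨⟨h1, h2, h3⟩, -⟩
    push_cast at h1 h2 h3
    rcases le_or_gt y (b + (2 - 1)) with hy | hy
    · right
      refine ⟨⟨h1, h2, by linarith⟩, hy⟩
    · left
      refine ⟨⟨h1, by linarith, by linarith⟩, ?_⟩
      rintro rfl
      norm_num at h1 h3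
      linarith

lemma unitCovered_sq_add_two (n : ℕ) (a b : ℝ) :
    UnitCovered (n ^ 2 + 2) {p | InTri 1 a b (n + 1 / (n + 1)) p.1 p.2} := by
  rcases n with _ | n
  · refine ⟨[(1, a, b), (1, a, b)], rfl, by simp, ?_⟩
    rintro ⟨x, y⟩ h
    exact ⟨(1, a, b), by simp, by simpa using h⟩
  -- With `n` now the predecessor, d solves (n+1)d + 1 = n + (2-d): the base of the strip equals its
  -- height plus the side of the remaining triangle.
  · set d : ℝ := (n + 1) / (n + 2) with hd
    have hn : (0 : ℝ) ≤ n := n.cast_nonneg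
    have e1 : ((n + 1 : ℕ) : ℝ) * d + 1 = ((n + 1 : ℕ) : ℝ) + 1 / (((n + 1 : ℕ) : ℝ) + 1) := by
      rw [hd]; push_cast; field_simp; ring
    have e2 : ((n + 1 : ℕ) : ℝ) + 1 / (((n + 1 : ℕ) : ℝ) + 1) = n + (2 - d) := by
      rw [hd]; push_cast; field_simp; ring
    have h := (unitCovered_sq n a (b + (2 - d))).union (unitCovered_strip (n + 1) a b d)
    rw [show n ^ 2 + (2 * (n + 1) + 1) = (n + 1) ^ 2 + 2 by ring] at h
    refine h.mono ?_
    rintro ⟨x, y⟩ ⟨h1, h2, h3⟩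
    rcases le_or_gt y (b + (2 - d)) with hy | hy
    · right
      exact ⟨⟨h1, h2, by rw [e1]; exact h3⟩, hy⟩
    · left
      rw [e2] at h3
      have hn0 : (0 : ℝ) < n := by
        simp only [one_mul] at h1 h3
        linarith
      exact ⟨⟨h1, by linarith, by linarith⟩, by rintro rfl; simp at hn0⟩

lemma coverable_of_unitCovered {N : ℕ} {T : Affine.Triangle ℝ Plane} {A : Set (ℝ × ℝ)}
    (h : UnitCovered N A) (hT : ∀ p ∈ T.closedInterior, (obX p, obY p) ∈ A) : Coverable N T := by
  obtain ⟨L, rfl, h1, h2⟩ := h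
  choose S hS hS' using fun k : Fin L.length =>
    exists_triangle (L.get k).2.1 (L.get k).2.2 (h1 _ (L.get_mem k)) one_pos
  refine ⟨S, hS, fun p hp => ?_⟩
  obtain ⟨q, hq, hpq⟩ := h2 _ (hT p hp)
  obtain ⟨k, rfl⟩ := List.get_of_mem hq
  rw [mem_iUnion]
  refine ⟨k, ?_⟩
  rw [hS' k]
  exact hpq

lemma coverable_sq_add_two (n : ℕ) (T : Affine.Triangle ℝ Plane)
    (hT : IsEquilateralH T ((n : ℝ) + 1 / ((n : ℝ) + 1))) : Coverable (n ^ 2 + 2) T := by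
  obtain ⟨σ, a, b, hσ, h⟩ := exists_region T (by positivity) hT
  rcases hσ with rfl | rfl
  · refine coverable_of_unitCovered (unitCovered_sq_add_two n a b) fun p hp => ?_
    rwa [h] at hp
  · refine coverable_of_unitCovered ((unitCovered_sq_add_two n (-a) (-b)).neg
      (A := {p | InTri (-1) a b (n + 1 / (n + 1)) p.1 p.2}) ?_) fun p hp => ?_
    · rintro ⟨x, y⟩ ⟨h1, h2, h3⟩
      refine ⟨?_, ?_, ?_⟩ <;> simp only [Prod.fst_neg, Prod.snd_neg] at * <;> linarith
    · rwa [h] at hp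

end HCover

/-! ### Integrals of fractional parts and the wasted length. -/

namespace HCover

open Set MeasureTheory intervalIntegral

/-- A primitive of the fractional part. -/
noncomputable def fractPrim (x : ℝ) : ℝ := x / 2 - Int.fract x * (1 - Int.fract x) / 2

/-- The correction u(1-u)/2 agrees at u = 0 and u = 1, so there is no jump at integers. -/
lemma continuous_fractPrim : Continuous fractPrim := by
  have h : Continuous fun x : ℝ => (fun u : ℝ => u * (1 - u) / 2) (Int.fract x) :=
    ContinuousOn.comp_fract'' (f := fun u : ℝ => u * (1 - u) / 2) (by fun_prop) (by norm_num)
  exact (continuous_id.div_const 2).sub h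

lemma hasDerivWithinAt_fractPrim (x : ℝ) :
    HasDerivWithinAt fractPrim (Int.fract x) (Ioi x) x := by
  have h : HasDerivAt (fun y : ℝ => y / 2 - (y - ⌊x⌋) * (1 - (y - ⌊x⌋)) / 2) (Int.fract x) x := by
    have h1 : HasDerivAt (fun y : ℝ => y - ⌊x⌋) 1 x := (hasDerivAt_id x).sub_const _
    have h2 := ((hasDerivAt_id x).div_const 2).sub ((h1.mul (h1.const_sub 1)).div_const 2)
    refine h2.congr_deriv ?_
    rw [← Int.self_sub_floor]
    ring
  refine h.hasDerivWithinAt.congr_of_eventuallyEq ?_ ?_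
  · have hx : x < ⌊x⌋ + 1 := Int.lt_floor_add_one x
    filter_upwards [Ioo_mem_nhdsGT hx] with y hy
    have : ⌊y⌋ = ⌊x⌋ := Int.floor_eq_iff.2 ⟨(Int.floor_le x).trans hy.1.le, hy.2⟩
    simp only [fractPrim, Int.fract, this]
  · simp only [fractPrim, Int.fract]

lemma intervalIntegrable_fract_comp {g : ℝ → ℝ} (hg : Measurable g) (p q : ℝ) :
    IntervalIntegrable (fun t => Int.fract (g t)) volume p q := by
  refine (intervalIntegrable_const (c := (1 : ℝ))).mono_fun'
    (hg.fract.aestronglyMeasurable) (Filter.Eventually.of_forall fun t => ?_)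
  dsimp only
  rw [Real.norm_of_nonneg (Int.fract_nonneg _)]
  exact (Int.fract_lt_one _).le

lemma integral_fract (a b : ℝ) : ∫ x in a..b, Int.fract x = fractPrim b - fractPrim a :=
  integral_eq_sub_of_hasDeriv_right continuous_fractPrim.continuousOn
    (fun x _ => hasDerivWithinAt_fractPrim x) (intervalIntegrable_fract_comp measurable_id a b)

lemma integral_fract_affine (c p q : ℝ) {κ : ℝ} (hκ : κ ≠ 0) :
    ∫ t in p..q, Int.fract (c + κ * t) =
      κ⁻¹ * (fractPrim (c + κ * q) - fractPrim (c + κ * p)) := by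
  rw [integral_comp_add_mul (fun x => Int.fract x) hκ, integral_fract, smul_eq_mul]

lemma fractPrim_add_one (x : ℝ) : fractPrim (x + 1) = fractPrim x + 1 / 2 := by
  simp only [fractPrim, Int.fract_add_one]
  ring

/-- The mean is 1/2 over full periods; the boundary terms r(1-r)/2 lie in [0, 1/8]. -/
lemma integral_fract_affine_ge (c : ℝ) {p q κ : ℝ} (hκ : κ ≠ 0) :
    (q - p) / 2 - |κ|⁻¹ / 8 ≤ ∫ t in p..q, Int.fract (c + κ * t) := by
  rw [integral_fract_affine c p q hκ]
  set r := Int.fract (c + κ * q) with hr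
  set r' := Int.fract (c + κ * p) with hr'
  have e : κ⁻¹ * (fractPrim (c + κ * q) - fractPrim (c + κ * p)) =
      (q - p) / 2 + κ⁻¹ * ((r' * (1 - r') - r * (1 - r)) / 2) := by
    simp only [fractPrim, ← hr, ← hr']
    field_simp
    ring
  have b1 : 0 ≤ r := Int.fract_nonneg _
  have b2 : r < 1 := Int.fract_lt_one _
  have b3 : 0 ≤ r' := Int.fract_nonneg _
  have b4 : r' < 1 := Int.fract_lt_one _
  have hb : |(r' * (1 - r') - r * (1 - r)) / 2| ≤ 1 / 8 := by
    rw [abs_le]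
    constructor <;> nlinarith [sq_nonneg (r - 1 / 2), sq_nonneg (r' - 1 / 2)]
  have h1 : |κ⁻¹ * ((r' * (1 - r') - r * (1 - r)) / 2)| ≤ |κ|⁻¹ * (1 / 8) := by
    rw [abs_mul, abs_inv]
    gcongr
  have h2 := neg_abs_le (κ⁻¹ * ((r' * (1 - r') - r * (1 - r)) / 2))
  rw [e]
  linarith

lemma fract_add_cases (x : ℝ) {l : ℝ} (h0 : 0 ≤ l) (h1 : l ≤ 1) :
    (Int.fract (x + l) = Int.fract x + l) ∨
      (1 ≤ Int.fract x + l ∧ Int.fract (x + l) = Int.fract x + l - 1) := by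
  have b1 := Int.fract_nonneg x
  have b2 := Int.fract_lt_one x
  rcases lt_or_ge (Int.fract x + l) 1 with h | h
  · left
    refine Int.fract_eq_iff.2 ⟨by linarith, h, ⌊x⌋, ?_⟩
    rw [Int.fract]; ring
  · right
    refine ⟨h, Int.fract_eq_iff.2 ⟨by linarith, by linarith, ⌊x⌋ + 1, ?_⟩⟩
    rw [Int.fract]; push_cast; ring

/-- The extreme case is a window starting at an integer. -/
lemma fractPrim_window (x : ℝ) {l : ℝ} (h0 : 0 ≤ l) (h1 : l ≤ 1) :
    l ^ 2 / 2 ≤ fractPrim (x + l) - fractPrim x := by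
  have b1 := Int.fract_nonneg x
  have b2 := Int.fract_lt_one x
  simp only [fractPrim]
  rcases fract_add_cases x h0 h1 with h | ⟨h, h'⟩
  · rw [h]
    nlinarith [mul_nonneg h0 b1]
  · rw [h']
    nlinarith [mul_nonneg (sub_nonneg.2 b2.le) (sub_nonneg.2 h1)]

lemma fractPrim_add_fract (x : ℝ) {l : ℝ} (h0 : 0 ≤ l) (h1 : l ≤ 1) :
    l - l ^ 2 / 2 ≤ fractPrim (x + l) - fractPrim x + (1 - l) * Int.fract (x + l) := by
  have b1 := Int.fract_nonneg x
  simp only [fractPrim]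
  rcases fract_add_cases x h0 h1 with h | ⟨h, h'⟩
  · rw [h]
    nlinarith
  · rw [h']
    nlinarith

lemma integral_one_sub_fract {σ : ℝ} (hσ : σ = 1 ∨ σ = -1) (β : ℝ) :
    ∫ t in (0 : ℝ)..1, (1 - Int.fract (σ * (t - β))) = 1 / 2 := by
  rw [integral_sub intervalIntegrable_const (intervalIntegrable_fract_comp (by fun_prop) _ _)]
  have hσ0 : σ ≠ 0 := by rcases hσ with rfl | rfl <;> norm_num
  have e : ∀ t, σ * (t - β) = -(σ * β) + σ * t := fun t => by ring
  simp only [e]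
  rw [integral_fract_affine _ _ _ hσ0]
  rcases hσ with rfl | rfl
  · simp only [mul_one, mul_zero, add_zero, fractPrim_add_one]
    norm_num
  · have h := fractPrim_add_one (-(-1 * β) + -1 * 1)
    rw [show -(-1 * β) + -1 * 1 + 1 = -(-1 * β) + -1 * 0 by ring] at h
    rw [h]
    norm_num

/-- The lower bound for the wasted length: the two integrands are the fractional parts of the
excess of the covering length over the length to be covered. -/
lemma wasted_length_bound {n : ℕ} (hn : 1 ≤ n) {ε : ℝ} (h1 : ε ≤ 1) (hε : 1 / ((n : ℝ) + 1) < ε)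
    {k : ℤ} (hk : Even k) (c : ℝ) :
    (n : ℝ) ^ 2 + 2 < (n + ε) ^ 2 + 2 * (∫ t in (0 : ℝ)..ε, Int.fract (c + ((k + 1 : ℤ) : ℝ) * t))
      + 2 * ∫ t in ε..1, Int.fract (c + ε + (k : ℝ) * t) := by
  have hn' : (1 : ℝ) ≤ n := by exact_mod_cast hn
  have hnp : (0 : ℝ) < n + 1 := by linarith
  have h0 : 0 < ε := lt_trans (by positivity) hε
  have hεn : 1 < ε * (n + 1) := (div_lt_iff₀ hnp).1 hε
  have hk1 : k + 1 ≠ 0 := by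
    rintro h
    obtain ⟨j, rfl⟩ := hk
    omega
  have hk1' : ((k + 1 : ℤ) : ℝ) ≠ 0 := by exact_mod_cast hk1
  -- The second integrand is constant here, and the claim reduces to 2ε(n+1) > 2: this case is
  -- sharp.
  by_cases hk0 : k = 0
  · subst hk0
    have e := fractPrim_add_fract c h0.le h1
    rw [integral_fract_affine _ _ _ hk1']
    simp
    nlinarith
  have hk0' : (k : ℝ) ≠ 0 := by exact_mod_cast hk0
  -- Also sharp, so the generic estimate fails; exact window bounds with slopes -1 and -2 give 3 +
  -- 2ε(2ε-1) on the right.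
  by_cases hs : k = -2 ∧ n = 1
  · obtain ⟨rfl, rfl⟩ := hs
    rw [integral_fract_affine _ _ _ hk1', integral_fract_affine _ _ _ hk0']
    have e1 := fractPrim_window (c - ε) h0.le h1
    push_cast at hεn ⊢
    have e2 := fractPrim_window (c + ε - 2) (l := 2 - 2 * ε) (by linarith) (by linarith)
    rw [show c - ε + ε = c by ring] at e1
    rw [show c + ε - 2 + (2 - 2 * ε) = c - ε by ring] at e2
    rw [show c + -1 * ε = c - ε by ring, show c + -1 * 0 = c by ring,
      show c + ε + -2 * 1 = c + ε - 2 by ring, show c + ε + -2 * ε = c - ε by ring]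
    norm_num
    nlinarith
  -- Twice the waste is at least 1 - (1/|k+1| + 1/|k|)/4, that is 5/8 for k = -2 and at least 19/24
  -- for the other even k ≠ 0.
  have b1 := integral_fract_affine_ge c (p := 0) (q := ε) hk1'
  have b2 := integral_fract_affine_ge (c + ε) (p := ε) (q := 1) hk0'
  have inv_le : ∀ (z : ℤ) (m : ℕ), 0 < m → (m : ℤ) ≤ |z| → |(z : ℝ)|⁻¹ ≤ (m : ℝ)⁻¹ := by
    intro z m hm h
    have : (m : ℝ) ≤ |(z : ℝ)| := by exact_mod_cast h
    have hm' : (0 : ℝ) < m := by exact_mod_cast hm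
    gcongr
  have i2 := inv_le k 2 (by norm_num) (by obtain ⟨j, rfl⟩ := hk; rw [le_abs]; push_cast; omega)
  by_cases hk2 : k = -2
  · have hn2 : (2 : ℝ) ≤ n := by
      have : 2 ≤ n := by omega
      exact_mod_cast this
    have i1 := inv_le (k + 1) 1 (by norm_num) (by subst hk2; norm_num)
    norm_num at i1 i2
    have : (n : ℝ) ^ 2 + 2 < (n + ε) ^ 2 + 5 / 8 := by
      have : n * ε + ε > 1 := by linarith
      by_cases h3 : ε ≤ 1 / 3
      · nlinarith
      · push Not at h3
        nlinarith
    push_cast at *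
    linarith
  · have i1 := inv_le (k + 1) 3 (by norm_num) (by obtain ⟨j, rfl⟩ := hk; rw [le_abs]; push_cast; omega)
    norm_num at i1 i2
    have : (n : ℝ) ^ 2 + 2 < (n + ε) ^ 2 + 19 / 24 := by
      by_cases h3 : ε ≤ 1 / 2
      · nlinarith
      · push Not at h3
        nlinarith
    push_cast at *
    linarith

end HCover

/-! ### Section lengths and the upper bound for ε. -/

namespace HCover

open Set MeasureTheory intervalIntegral

/-- The length of the section of a unit triangle at (signed) height `z` above its horizontal
side. -/
noncomputable def secLen (z : ℝ) : ℝ := if 0 ≤ z then max 0 (1 - z) else 0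

lemma secLen_nonneg (z : ℝ) : 0 ≤ secLen z := by
  unfold secLen
  split_ifs
  · exact le_max_left _ _
  · exact le_rfl

/-- The sections of a unit triangle by lines at distinct integer offsets. -/
lemma sum_secLen_le (z : ℝ) {g : ℕ → ℤ} (hg : Function.Injective g) (K : ℕ) :
    ∑ j ∈ Finset.range K, secLen (z + g j) ≤ 1 - Int.fract z := by
  -- Only m = -⌊z⌋ puts z + m in [0,1).
  have hz : ∀ m : ℤ, m ≠ -⌊z⌋ → secLen (z + m) = 0 := by
    intro m hm
    unfold secLen
    split_ifs with h
    · refine max_eq_left ?_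
      have h1 : -⌊z⌋ ≤ m := by
        have : (0 : ℤ) ≤ ⌊z + m⌋ := Int.floor_nonneg.2 h
        rw [Int.floor_add_intCast] at this
        linarith
      have h2 : -⌊z⌋ + 1 ≤ m := by omega
      have h3 : (-⌊z⌋ + 1 : ℝ) ≤ m := by exact_mod_cast h2
      linarith [Int.floor_le z]
    · rfl
  have h0 : secLen (z + (-⌊z⌋ : ℤ)) = 1 - Int.fract z := by
    have e : z + (-⌊z⌋ : ℤ) = Int.fract z := by rw [Int.fract]; push_cast; ring
    rw [e, secLen, if_pos (Int.fract_nonneg z), max_eq_right]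
    linarith [Int.fract_lt_one z]
  have hnn : 0 ≤ 1 - Int.fract z := by linarith [Int.fract_lt_one z]
  by_cases hex : ∃ i ∈ Finset.range K, g i = -⌊z⌋
  · obtain ⟨i, hi, hgi⟩ := hex
    rw [Finset.sum_eq_single_of_mem i hi, hgi, h0]
    intro j _ hji
    exact hz _ fun h => hji (hg (h.trans hgi.symm))
  · rw [Finset.sum_eq_zero]
    · exact hnn
    · intro j hj
      exact hz _ fun h => hex ⟨j, hj, h⟩

/-- Comparing lengths on a horizontal line. -/
lemma length_le_sum_secLen {ι : Type*} [Fintype ι] {σ a b : ι → ℝ} {a₀ b₀ s y : ℝ}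
    (hσ : ∀ i, σ i = 1 ∨ σ i = -1)
    (hcov : ∀ x y, InTri 1 a₀ b₀ s x y → ∃ i, InTri (σ i) (a i) (b i) 1 x y)
    (hy0 : b₀ ≤ y) : s - (y - b₀) ≤ ∑ i, secLen (σ i * (y - b i)) := by
  have hsub : Icc a₀ (a₀ + (s - (y - b₀))) ⊆ ⋃ i, {x | InTri (σ i) (a i) (b i) 1 x y} := by
    rintro x ⟨h1, h2⟩
    rw [mem_iUnion]
    exact hcov x y ⟨by linarith, by linarith, by linarith⟩
  have hsec : ∀ i, volume {x | InTri (σ i) (a i) (b i) 1 x y} ≤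
      ENNReal.ofReal (secLen (σ i * (y - b i))) := by
    intro i
    by_cases h : 0 ≤ σ i * (y - b i)
    · have hle : 1 - σ i * (y - b i) ≤ secLen (σ i * (y - b i)) := by
        rw [secLen, if_pos h]; exact le_max_right _ _
      generalize secLen (σ i * (y - b i)) = l at *
      rcases hσ i with hi | hi
      · simp only [hi] at h hle ⊢
        calc _ ≤ volume (Icc (a i) (a i + l)) := by
              refine measure_mono ?_
              rintro x ⟨h1, h2, h3⟩
              constructor <;> linarith
          _ = _ := by rw [Real.volume_Icc]; congr 1; ring
      · simp only [hi] at h hle ⊢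
        calc _ ≤ volume (Icc (a i - l) (a i)) := by
              refine measure_mono ?_
              rintro x ⟨h1, h2, h3⟩
              constructor <;> linarith
          _ = _ := by rw [Real.volume_Icc]; congr 1; ring
    · have : {x | InTri (σ i) (a i) (b i) 1 x y} = ∅ := by
        ext x
        simp only [mem_ofPred_eq, mem_empty_iff_false, iff_false]
        rintro ⟨_, h2, _⟩
        exact h h2
      rw [this]
      simp
  have h := (measure_mono hsub).trans ((measure_iUnion_fintype_le volume _).trans
    (Finset.sum_le_sum fun i _ => hsec i))
  rw [Real.volume_Icc, ← ENNReal.ofReal_sum_of_nonneg (fun i _ => secLen_nonneg _),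
    ENNReal.ofReal_le_ofReal_iff (Finset.sum_nonneg fun i _ => secLen_nonneg _)] at h
  linarith

/-- Comparing lengths on `K` horizontal lines at integer distances. -/
lemma sum_lengths_le {ι : Type*} [Fintype ι] {σ a b : ι → ℝ} {a₀ b₀ s t : ℝ}
    (hσ : ∀ i, σ i = 1 ∨ σ i = -1)
    (hcov : ∀ x y, InTri 1 a₀ b₀ s x y → ∃ i, InTri (σ i) (a i) (b i) 1 x y)
    (ht : 0 ≤ t) (K : ℕ) :
    K * (s - t) - K * (K - 1) / 2 ≤ ∑ i, (1 - Int.fract (σ i * (t - (b i - b₀)))) := by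
  calc K * (s - t) - K * ((K : ℝ) - 1) / 2 = ∑ j ∈ Finset.range K, (s - (t + j)) := by
        induction K with
        | zero => simp
        | succ K ih => rw [Finset.sum_range_succ, ← ih]; push_cast; ring
    _ ≤ ∑ j ∈ Finset.range K, ∑ i, secLen (σ i * (b₀ + t + j - b i)) := by
        -- Above the big triangle the left side is negative, so K needs no bound.
        refine Finset.sum_le_sum fun j _ => ?_
        have hj : (0 : ℝ) ≤ j := j.cast_nonneg
        have := length_le_sum_secLen hσ hcov (y := b₀ + t + j) (by linarith)
        linarith
    _ = ∑ i, ∑ j ∈ Finset.range K, secLen (σ i * (b₀ + t + j - b i)) := Finset.sum_comm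
    _ ≤ _ := by
        refine Finset.sum_le_sum fun i _ => ?_
        rcases hσ i with hi | hi
        · refine le_trans (le_of_eq ?_) (sum_secLen_le _ (g := fun j => (j : ℤ))
            Nat.cast_injective K)
          refine Finset.sum_congr rfl fun j _ => ?_
          congr 1
          rw [hi]; push_cast; ring
        · refine le_trans (le_of_eq ?_) (sum_secLen_le _ (g := fun j => -(j : ℤ))
            (neg_injective.comp Nat.cast_injective) K)
          refine Finset.sum_congr rfl fun j _ => ?_
          congr 1
          rw [hi]; push_cast; ring

lemma exists_sum_signs {ι : Type*} [Fintype ι] {σ : ι → ℝ} (hσ : ∀ i, σ i = 1 ∨ σ i = -1) :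
    ∃ j : ℤ, ∑ i, σ i = 2 * j - Fintype.card ι := by
  have : ∀ i, ∃ e : ℤ, σ i = 2 * e - 1 := fun i => by
    rcases hσ i with h | h
    · exact ⟨1, by rw [h]; norm_num⟩
    · exact ⟨0, by rw [h]; norm_num⟩
  choose e he using this
  refine ⟨∑ i, e i, ?_⟩
  simp only [he, Finset.sum_sub_distrib, ← Finset.mul_sum]
  simp

/-- A nonnegative quantity is at least the fractional part of anything it is congruent to. -/
lemma fract_le_sum_sub {ι : Type*} [Fintype ι] (σ β : ι → ℝ) (t w : ℝ)
    (h : w ≤ ∑ i, (1 - Int.fract (σ i * (t - β i)))) :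
    w + Int.fract (∑ i, σ i * β i - (∑ i, σ i) * t - w) ≤
      ∑ i, (1 - Int.fract (σ i * (t - β i))) := by
  -- Each 1 - fract u equals (1 + ⌊u⌋) - u, an integer minus u.
  have e : ∑ i, (1 - Int.fract (σ i * (t - β i))) - w =
      (∑ i, σ i * β i - (∑ i, σ i) * t - w) + ((∑ i, (1 + ⌊σ i * (t - β i)⌋) : ℤ) : ℝ) := by
    push_cast
    simp only [Int.fract, mul_sub, Finset.sum_sub_distrib, Finset.sum_add_distrib, Finset.sum_mul]
    ring
  have h0 : 0 ≤ ∑ i, (1 - Int.fract (σ i * (t - β i))) - w := sub_nonneg.2 h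
  have h1 : Int.fract (∑ i, σ i * β i - (∑ i, σ i) * t - w) ≤
      ∑ i, (1 - Int.fract (σ i * (t - β i))) - w := by
    rw [← Int.fract_add_intCast _ (∑ i, (1 + ⌊σ i * (t - β i)⌋)), ← e, Int.fract]
    have : (0 : ℝ) ≤ ⌊∑ i, (1 - Int.fract (σ i * (t - β i))) - w⌋ := by
      exact_mod_cast Int.floor_nonneg.2 h0
    linarith
  linarith

lemma le_of_cover_of_le_one {n : ℕ} (hn : 1 ≤ n) {ε : ℝ} (h0 : 0 < ε) (h1 : ε ≤ 1)
    {σ a b : Fin (n ^ 2 + 2) → ℝ} {a₀ b₀ : ℝ} (hσ : ∀ i, σ i = 1 ∨ σ i = -1)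
    (hcov : ∀ x y, InTri 1 a₀ b₀ (n + ε) x y → ∃ i, InTri (σ i) (a i) (b i) 1 x y) :
    ε ≤ 1 / ((n : ℝ) + 1) := by
  by_contra! hlt
  obtain ⟨j, hj⟩ := exists_sum_signs hσ
  set β : Fin (n ^ 2 + 2) → ℝ := fun i => b i - b₀ with hβ
  set f : ℝ → ℝ := fun t => ∑ i, (1 - Int.fract (σ i * (t - β i))) with hf
  -- k is n - ∑ σ: modulo 1, f has slope -∑ σ = k - n, while W has slope -(n+1) on [0,ε] and -n on
  -- [ε,1].
  set k : ℤ := n - (2 * j - (n ^ 2 + 2)) with hkdef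
  have hk : Even k := by
    have h : Even ((n : ℤ) * (n + 1)) := Int.even_mul_succ_self n
    have e : k = n * (n + 1) + 2 * (1 - j) := by rw [hkdef]; ring
    rw [e]
    exact h.add (even_two_mul _)
  have hsum : ∑ i, σ i = n - k := by
    rw [hj, hkdef, Fintype.card_fin]; push_cast; ring
  set A : ℝ := n * (n + 1) / 2 + (n + 1) * ε with hA
  set c : ℝ := ∑ i, σ i * β i - A with hc
  have hint1 : ∀ i, ∀ p q : ℝ,
      IntervalIntegrable (fun t => 1 - Int.fract (σ i * (t - β i))) volume p q := fun i p q =>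
    intervalIntegrable_const.sub (intervalIntegrable_fract_comp (by fun_prop) p q)
  have hint : ∀ p q : ℝ, IntervalIntegrable f volume p q := fun p q => by
    have h := IntervalIntegrable.sum Finset.univ fun i _ => hint1 i p q
    rwa [show (∑ i, fun t => 1 - Int.fract (σ i * (t - β i))) = f by
      ext t
      rw [Finset.sum_apply]] at h
  have htot : ∫ t in (0 : ℝ)..1, f t = ((n : ℝ) ^ 2 + 2) / 2 := by
    rw [hf, integral_finsetSum fun i _ => hint1 i 0 1]
    simp only [integral_one_sub_fract (hσ _)]
    simp
    ring
  have hlow : ∀ t ∈ Icc (0 : ℝ) ε,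
      A - (n + 1) * t + Int.fract (c + ((k + 1 : ℤ) : ℝ) * t) ≤ f t := by
    intro t ht
    have h := sum_lengths_le hσ hcov ht.1 (n + 1)
    have := fract_le_sum_sub σ β t (A - (n + 1) * t) (by
      refine le_trans (le_of_eq ?_) h
      rw [hA]; push_cast; ring)
    refine le_trans (le_of_eq ?_) this
    congr 2
    rw [hsum, hc]; push_cast; ring
  have hhigh : ∀ t ∈ Icc ε 1,
      A - ε - n * t + Int.fract (c + ε + (k : ℝ) * t) ≤ f t := by
    intro t ht
    have h := sum_lengths_le hσ hcov (h0.le.trans ht.1) n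
    have := fract_le_sum_sub σ β t (A - ε - n * t) (by
      refine le_trans (le_of_eq ?_) h
      rw [hA]; ring)
    refine le_trans (le_of_eq ?_) this
    congr 2
    rw [hsum, hc]; ring
  have hlin : ∀ u v p q : ℝ, ∫ t in p..q, (u - v * t) = u * (q - p) - v * (q ^ 2 - p ^ 2) / 2 := by
    intro u v p q
    rw [integral_sub intervalIntegrable_const
      (Continuous.intervalIntegrable (by fun_prop) _ _), intervalIntegral.integral_const_mul]
    simp
    ring
  have hlini : ∀ u v p q : ℝ, IntervalIntegrable (fun t => u - v * t) volume p q := fun u v p q =>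
    Continuous.intervalIntegrable (by fun_prop) _ _
  have hfr : ∀ u v p q : ℝ, IntervalIntegrable (fun t => Int.fract (u + v * t)) volume p q :=
    fun u v p q => intervalIntegrable_fract_comp (by fun_prop) p q
  have i1 := integral_mono_on h0.le ((hlini A (n + 1) 0 ε).add (hfr c ((k + 1 : ℤ) : ℝ) 0 ε))
    (hint 0 ε) hlow
  have i2 := integral_mono_on h1 ((hlini (A - ε) n ε 1).add (hfr (c + ε) k ε 1))
    (hint ε 1) hhigh
  rw [integral_add (hlini _ _ _ _) (hfr _ _ _ _), hlin] at i1 i2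
  rw [← integral_add_adjacent_intervals (hint 0 ε) (hint ε 1)] at htot
  have hw := wasted_length_bound hn h1 hlt hk c
  rw [hA] at i1 i2
  nlinarith

/-! ### Transfer to triangles in the plane. -/

lemma exists_inTri_of_coverable {N : ℕ} {T : Affine.Triangle ℝ Plane} (h : Coverable N T) :
    ∃ σ a b : Fin N → ℝ, (∀ i, σ i = 1 ∨ σ i = -1) ∧ ∀ x y, ofOb x y ∈ T.closedInterior →
      ∃ i, InTri (σ i) (a i) (b i) 1 x y := by
  obtain ⟨S, hS, hcov⟩ := h
  choose σ a b hσ hreg using fun i => exists_region (S i) one_pos (hS i)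
  refine ⟨σ, a, b, hσ, fun x y hxy => ?_⟩
  obtain ⟨i, hi⟩ := mem_iUnion.1 (hcov hxy)
  rw [hreg i] at hi
  exact ⟨i, by simpa using hi⟩

/-- Up to reflection, a coverable triangle points upwards. -/
lemma exists_up_cover {N : ℕ} {T : Affine.Triangle ℝ Plane} {s : ℝ} (hs : 0 < s)
    (hT : IsEquilateralH T s) (h : Coverable N T) :
    ∃ (σ a b : Fin N → ℝ) (a₀ b₀ : ℝ), (∀ i, σ i = 1 ∨ σ i = -1) ∧
      ∀ x y, InTri 1 a₀ b₀ s x y → ∃ i, InTri (σ i) (a i) (b i) 1 x y := by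
  obtain ⟨τ, a₀, b₀, hτ, hreg⟩ := exists_region T hs hT
  obtain ⟨σ, a, b, hσ, hcov⟩ := exists_inTri_of_coverable h
  simp only [hreg, mem_ofPred_eq, obX_ofOb, obY_ofOb] at hcov
  rcases hτ with rfl | rfl
  · exact ⟨σ, a, b, a₀, b₀, hσ, hcov⟩
  · refine ⟨-σ, -a, -b, -a₀, -b₀, fun i => ?_, fun x y hxy => ?_⟩
    · rcases hσ i with h | h <;> simp [h]
    · obtain ⟨h1, h2, h3⟩ := hxy
      obtain ⟨i, h4, h5, h6⟩ := hcov (-x) (-y) ⟨by linarith, by linarith, by linarith⟩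
      refine ⟨i, ?_, ?_, ?_⟩ <;> simp only [Pi.neg_apply] <;> linarith

/-- Two unit triangles cannot cover all three vertices of a larger triangle. -/
lemma le_one_of_cover_two {s : ℝ} (hs : 0 < s) {σ a b : Fin 2 → ℝ} {a₀ b₀ : ℝ}
    (hσ : ∀ i, σ i = 1 ∨ σ i = -1)
    (hcov : ∀ x y, InTri 1 a₀ b₀ s x y → ∃ i, InTri (σ i) (a i) (b i) 1 x y) : s ≤ 1 := by
  obtain ⟨i, h1, h2, h3⟩ := hcov a₀ b₀ ⟨by simp, by simp, by simp [hs.le]⟩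
  obtain ⟨j, h4, h5, h6⟩ := hcov (a₀ + s) b₀ ⟨by simp [hs.le], by simp, by simp⟩
  obtain ⟨l, h7, h8, h9⟩ := hcov a₀ (b₀ + s) ⟨by simp, by simp [hs.le], by simp⟩
  have : i = j ∨ i = l ∨ j = l := by omega
  rcases this with rfl | rfl | rfl
  · rcases hσ i with h | h <;> simp only [h] at h1 h2 h3 h4 h5 h6 <;> linarith
  · rcases hσ i with h | h <;> simp only [h] at h1 h2 h3 h7 h8 h9 <;> linarith
  · rcases hσ j with h | h <;> simp only [h] at h4 h5 h6 h7 h8 h9 <;> linarith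

lemma le_of_coverable {n : ℕ} {ε : ℝ} (h0 : 0 < ε) {T : Affine.Triangle ℝ Plane}
    (hT : IsEquilateralH T ((n : ℝ) + ε)) (h : Coverable (n ^ 2 + 2) T) :
    ε ≤ 1 / ((n : ℝ) + 1) := by
  have hn : (0 : ℝ) ≤ n := n.cast_nonneg
  obtain ⟨σ, a, b, a₀, b₀, hσ, hcov⟩ := exists_up_cover (by positivity) hT h
  rcases Nat.eq_zero_or_pos n with rfl | hpos
  · have := le_one_of_cover_two (by positivity) hσ hcov
    simpa using this
  -- Shrinking to min ε 1 keeps the break point within one period; since 1/(n+1) < 1, the bound then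
  -- applies to ε itself.
  · have hmin := le_of_cover_of_le_one hpos (lt_min h0 one_pos) (min_le_right ε 1) hσ
      (a₀ := a₀) (b₀ := b₀) fun x y hxy => hcov x y
        ⟨hxy.1, hxy.2.1, hxy.2.2.trans (by gcongr; exact min_le_left _ _)⟩
    have hn1 : (1 : ℝ) ≤ n := by exact_mod_cast hpos
    have hlt : 1 / ((n : ℝ) + 1) < 1 := by
      rw [div_lt_one (by positivity)]; linarith
    rcases min_le_iff.1 hmin with h | h
    · exact h
    · linarith

end HCover

theorem mainTheorem4 (n : ℕ) :
    IsGreatest {ε : ℝ | 0 < ε ∧ ∃ T : Affine.Triangle ℝ HCover.Plane,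
        HCover.IsEquilateralH T ((n : ℝ) + ε) ∧ HCover.Coverable (n ^ 2 + 2) T}
      (1 / ((n : ℝ) + 1)) ∧
    IsGreatest {ε : ℝ | 0 < ε ∧ ∀ T : Affine.Triangle ℝ HCover.Plane,
        HCover.IsEquilateralH T ((n : ℝ) + ε) → HCover.Coverable (n ^ 2 + 2) T}
      (1 / ((n : ℝ) + 1)) := by
  have ex : ∀ ε : ℝ, 0 < ε → ∃ T : Affine.Triangle ℝ HCover.Plane,
      HCover.IsEquilateralH T ((n : ℝ) + ε) := fun ε hε =>
    (HCover.exists_triangle 0 0 (Or.inl rfl) (by positivity)).imp fun T h => h.1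
  have hpos : 0 < 1 / ((n : ℝ) + 1) := by positivity
  refine ⟨⟨⟨hpos, ?_⟩, ?_⟩, ⟨⟨hpos, HCover.coverable_sq_add_two n⟩, ?_⟩⟩
  · obtain ⟨T, hT⟩ := ex _ hpos
    exact ⟨T, hT, HCover.coverable_sq_add_two n T hT⟩
  · rintro ε ⟨hε, T, hT, hc⟩
    exact HCover.le_of_coverable hε hT hc
  · rintro ε ⟨hε, h⟩
    obtain ⟨T, hT⟩ := ex ε hε
    exact HCover.le_of_coverable hε hT (h T hT)
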